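/- **Setting.** Let $p$ be a prime number, $R$ a commutative ring with an endomorphism $F$ lifting the absolute Frobenius of $R/p$, and $q\in R$. For $n\in\mathbb N$ put $(n)_q=1+q+\dots+q^{n-1}\in R$. Assume that $(p)_q=0$ in $R$ and that $R$ is $q$-divisible: each $(m)_q$, $m\in\mathbb N$, is zero or invertible in $R$. Let $A$ be a commutative $R$-algebra with an étale morphism of $R$-algebras $f:R[t]\to A$, and put $x=f(t)$. Let $A'=R\otimes_{F,R}A$ be the base change of $A$ along $F:R\to R$, an $R$-algebra through the left factor. Assume given * an endomorphism $\sigma$ of the $R$-algebra $A$ with $\sigma(x)=qx$; * an $R$-linear map $\partial_\sigma:A\to A$ with $\partial_\sigma(x)=1$ and $\partial_\sigma(z_1z_2)=\partial_\sigma(z_1)z_2+\sigma(z_1)\partial_\sigma(z_2)$ for all $z_1,z_2\in A$; * a morphism of $R$-algebras $F^*:A'\to A$ with $F^*(1\otimes x)=x^p$, such that $1,x,\dots,x^{p-1}$ is a basis of $A$ as an $A'$-module through $F^*$. A $\sigma$-derivation of an $A$-module $M$ is an $R$-linear map $\partial_{\sigma,M}:M\to M$ with $\partial_{\sigma,M}(am)=\partial_\sigma(a)m+\sigma(a)\partial_{\sigma,M}(m)$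 for all $a\in A$, $m\in M$. An endomorphism $u$ of an abelian group $G$ is quasi-nilpotent if for every $g\in G$ there is $n\in\mathbb N$ with $u^n(g)=0$. Let $M$ be an $A$-module with a quasi-nilpotent $\sigma$-derivation $\partial_{\sigma,M}$, and let $H$ be an $A'$-module with a quasi-nilpotent $A'$-linear endomorphism $u_H$. We say that $(M,\partial_{\sigma,M})$ and $(H,u_H)$ correspond to each other if $(M,\partial_{\sigma,M})$ is isomorphic, as an $A$-module with a $\sigma$-derivation, to $\mathbb M_q(H,u_H)$, that is, to $A\otimes_{A'}H$ with the unique $\sigma$-derivation such that $1\otimes h\mapsto x^{p-1}\otimes u_H(h)$ for all $h\in H$. Consider the complexes of $R$-modules, with $M$ and $H$ in degree $0$, $$q\text{-}\mathrm{DR}(M/R):\quad 0\to M\to M\otimes_A\Omega^1_{A/R}\to 0,\qquad m\mapsto\partial_{\sigma,M}(m)\otimes dx,$$ $$\mathrm{Higgs}(H/R):\quad 0\to H\to H\otimes_{A'}\Omega^1_{A'/R}\to 0,\qquad h\mapsto u_H(h)\otimes d(1\otimes x).$$ **Proposition.** If $(M,\partial_{\sigma,M})$ and $(H,u_H)$ correspond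 to each other, then $q\text{-}\mathrm{DR}(M/R)$ is quasi-isomorphic to $\mathrm{Higgs}(H/R)$: there is a morphism of complexes of $R$-modules $\mathrm{Higgs}(H/R)\to q\text{-}\mathrm{DR}(M/R)$ which is a quasi-isomorphism. -/

import Mathlib

open CategoryTheory
open scoped TensorProduct

universe u

namespace QSimpson

section Rings

variable {R : Type u} [CommRing R]

/-- The `q`-integer `(n)_q = 1 + q + ... + q ^ (n - 1)`. -/
def qInt (q : R) (n : ℕ) : R := ∑ i ∈ Finset.range n, q ^ i

/-- `R` is `q`-divisible: every `q`-integer `(m)_q` which is nonzero in `R` is invertible. -/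
def IsQDivisible (q : R) : Prop := ∀ m : ℕ, qInt q m ≠ 0 → IsUnit (qInt q m)

/-- `F` is a lift to `R` of the absolute Frobenius of `R / p`. -/
def IsFrobeniusLift (p : ℕ) (F : R →+* R) : Prop :=
  ∀ r : R, F r - r ^ p ∈ Ideal.span {(p : R)}

/-- A copy of the ring `R`, which is considered as an `R`-algebra through `F : R → R`. -/
def FrobSource (_F : R →+* R) : Type u := R

instance (F : R →+* R) : CommRing (FrobSource F) := inferInstanceAs (CommRing R)

instance (F : R →+* R) : Algebra R (FrobSource F) :=
  RingHom.toAlgebra (S := FrobSource F) F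

/-- The Frobenius twist `A' = R ⊗_{F, R} A` of an `R`-algebra `A`: in `A'` one has
`r ⊗ s • a = r * F s ⊗ a`. -/
def FrobTwist (F : R →+* R) (A : Type u) [CommRing A] [Algebra R A] : Type u :=
  FrobSource F ⊗[R] A

variable (F : R →+* R) (A : Type u) [CommRing A] [Algebra R A]

instance : CommRing (FrobTwist F A) := inferInstanceAs (CommRing (FrobSource F ⊗[R] A))

/-- `A'` is an `R`-algebra through the left factor: `r ↦ r ⊗ 1`. -/
instance : Algebra R (FrobTwist F A) :=
  RingHom.toAlgebra (S := FrobTwist F A)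
    (Algebra.TensorProduct.includeLeftRingHom (R := R) (A := FrobSource F) (B := A))

variable {A}

/-- The element `1 ⊗ a` of `A'`. -/
def FrobTwist.one_tmul (a : A) : FrobTwist F A := (1 : FrobSource F) ⊗ₜ[R] a

end Rings

/-- An endomorphism `u` of an abelian group `G` is quasi-nilpotent if every element of `G` is
killed by some power of `u`. -/
def IsQuasiNilpotent {G : Type u} [AddCommGroup G] (u : G → G) : Prop :=
  ∀ g : G, ∃ n : ℕ, u^[n] g = 0

section Modules

variable {R : Type u} [CommRing R] {A : Type u} [CommRing A] [Algebra R A]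

/-- `∂M` is a `σ`-derivation of the `A`-module `M`, with respect to the `σ`-derivation `∂` of `A`:
`∂M (a m) = ∂ a • m + σ a • ∂M m`. For `M = A` and `∂M = ∂` this says that `∂` is itself a
`σ`-derivation of `A`. -/
def IsTwistedDerivation (σ : A →ₐ[R] A) (d : A →ₗ[R] A)
    {M : Type u} [AddCommGroup M] [Module R M] [Module A M] (dM : M →ₗ[R] M) : Prop :=
  ∀ (a : A) (m : M), dM (a • m) = d a • m + σ a • dM m

section Correspondence

variable {F : R →+* R} [Algebra (FrobTwist F A) A] [IsScalarTower R (FrobTwist F A) A]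
variable {H : Type u} [AddCommGroup H] [Module (FrobTwist F A) H]

/-- `dMH` is the `σ`-derivation of `A ⊗_{A'} H` that defines the object `𝕄_q (H, uH)`, namely the
`σ`-derivation such that `dMH (1 ⊗ h) = x ^ (p - 1) ⊗ uH h` for all `h`. Here `A` is an
`A'`-algebra through the Frobenius `F^* : A' → A`. -/
structure IsMqDerivation (p : ℕ) (σ : A →ₐ[R] A) (d : A →ₗ[R] A) (x : A)
    (uH : H →ₗ[FrobTwist F A] H)
    (dMH : (A ⊗[FrobTwist F A] H) →ₗ[R] (A ⊗[FrobTwist F A] H)) : Prop where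
  isTwistedDerivation : IsTwistedDerivation σ d dMH
  apply_one_tmul : ∀ h : H, dMH (1 ⊗ₜ h) = (x ^ (p - 1)) ⊗ₜ uH h

/-- The `σ`-derivation that defines `𝕄_q (H, uH)` is unique. -/
theorem IsMqDerivation.unique {p : ℕ} {σ : A →ₐ[R] A} {d : A →ₗ[R] A} {x : A}
    {uH : H →ₗ[FrobTwist F A] H}
    {d₁ d₂ : (A ⊗[FrobTwist F A] H) →ₗ[R] (A ⊗[FrobTwist F A] H)}
    (h₁ : IsMqDerivation p σ d x uH d₁) (h₂ : IsMqDerivation p σ d x uH d₂) : d₁ = d₂ := by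
  ext z
  induction z using TensorProduct.induction_on with
  | zero => simp
  | add z w hz hw => simp [hz, hw]
  | tmul a h =>
    have e : a ⊗ₜ[FrobTwist F A] h = a • ((1 : A) ⊗ₜ[FrobTwist F A] h) := by
      simp [TensorProduct.smul_tmul']
    rw [e, h₁.isTwistedDerivation, h₂.isTwistedDerivation, h₁.apply_one_tmul, h₂.apply_one_tmul]

/-- `(M, dM)` and `(H, uH)` correspond to each other: `(M, dM)` is isomorphic, as an `A`-module
with a `σ`-derivation, to `𝕄_q (H, uH) = (A ⊗_{A'} H, dMH)`. -/
def Corresponds (p : ℕ) (σ : A →ₐ[R] A) (d : A →ₗ[R] A) (x : A)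
    {M : Type u} [AddCommGroup M] [Module R M] [Module A M] (dM : M →ₗ[R] M)
    (uH : H →ₗ[FrobTwist F A] H) : Prop :=
  ∃ dMH : (A ⊗[FrobTwist F A] H) →ₗ[R] (A ⊗[FrobTwist F A] H),
    IsMqDerivation p σ d x uH dMH ∧
      ∃ e : (A ⊗[FrobTwist F A] H) ≃ₗ[A] M, ∀ z, e (dMH z) = dM (e z)

end Correspondence

section Complexes

/-- For an `R`-linear endomorphism `v` of a `B`-module `N` and `b : B`, the `R`-linear map
`N → N ⊗_B Ω¹_{B/R}`, `n ↦ v n ⊗ db`. -/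
noncomputable def tmulD {B : Type u} [CommRing B] [Algebra R B]
    {N : Type u} [AddCommGroup N] [Module R N] [Module B N] [IsScalarTower R B N]
    (v : N →ₗ[R] N) (b : B) : N →ₗ[R] N ⊗[B] (Ω[B⁄R]) where
  toFun n := v n ⊗ₜ KaehlerDifferential.D R B b
  map_add' n m := by rw [map_add, TensorProduct.add_tmul]
  map_smul' r n := by rw [map_smul, RingHom.id_apply, TensorProduct.smul_tmul']

/-- The two-term cochain complex `0 → N → N ⊗_B Ω¹_{B/R} → 0` of `R`-modules with `N` in degree
`0`, `N ⊗_B Ω¹_{B/R}` in degree `1` and differential `n ↦ v n ⊗ db`. -/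
noncomputable def twoTermComplex {B : Type u} [CommRing B] [Algebra R B]
    {N : Type u} [AddCommGroup N] [Module R N] [Module B N] [IsScalarTower R B N]
    (v : N →ₗ[R] N) (b : B) : CochainComplex (ModuleCat.{u} R) ℤ :=
  HomologicalComplex.double (c := ComplexShape.up ℤ) (i₀ := 0) (i₁ := 1)
    (ModuleCat.ofHom (tmulD v b)) (by simp)

/-- The `q`-de Rham complex `0 → M → M ⊗_A Ω¹_{A/R} → 0`, `m ↦ dM m ⊗ dx`. -/
noncomputable def qDeRham (x : A)
    {M : Type u} [AddCommGroup M] [Module R M] [Module A M] [IsScalarTower R A M]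
    (dM : M →ₗ[R] M) : CochainComplex (ModuleCat.{u} R) ℤ :=
  twoTermComplex dM x

/-- The Higgs complex `0 → H → H ⊗_{A'} Ω¹_{A'/R} → 0`, `h ↦ uH h ⊗ d(1 ⊗ x)`. -/
noncomputable def higgs (F : R →+* R) (x : A)
    {H : Type u} [AddCommGroup H] [Module R H] [Module (FrobTwist F A) H]
    [IsScalarTower R (FrobTwist F A) H]
    (uH : H →ₗ[FrobTwist F A] H) : CochainComplex (ModuleCat.{u} R) ℤ :=
  twoTermComplex (uH.restrictScalars R) (FrobTwist.one_tmul F x)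

end Complexes

end Modules

end QSimpson

/-! The basis `1, x, ..., x^(p-1)` splits `M` into copies `x^i ⊗ H`. The derivation shifts them
cyclically: `1 ⊗ h` goes to `x^(p-1) ⊗ u h`, and for `0 < i < p` the Leibniz rule with `x^p = F^*(1
⊗ x)` sends `x^i ⊗ h` to `x^(i-1) ⊗ w h`, where `w = (i)_q + q^i (1 ⊗ x) u`. Here `(i)_q` is a unit
(`isUnit_qInt`) and `u` is locally nilpotent, so `w` is bijective
(`Module.End.bijective_smul_add_of_locallyNilpotent`). Only the piece from `1 ⊗ H` to `x^(p-1) ⊗ H`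
survives up to homotopy; it is the Higgs complex, since both modules of differentials are free on
the differential of the coordinate. `exists_quasiIso_twoTermComplex` carries this out. -/

/-! ### Deformation retracts of two-term complexes -/

section Double

open CategoryTheory HomologicalComplex Limits

variable {C : Type*} [Category* C] [Preadditive C] [HasZeroObject C]

/-- Two cochain complexes concentrated in degrees `0` and `1` are linked by a quasi-isomorphism as
soon as one is a deformation retract of the other. -/
theorem HomologicalComplex.exists_quasiIso_double [CategoryWithHomology C] {X₀ X₁ Y₀ Y₁ : C}
    (f : X₀ ⟶ X₁) (g : Y₀ ⟶ Y₁)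
    (φ₀ : X₀ ⟶ Y₀) (φ₁ : X₁ ⟶ Y₁) (r₀ : Y₀ ⟶ X₀) (r₁ : Y₁ ⟶ X₁) (s : Y₁ ⟶ Y₀)
    (hφ : φ₀ ≫ g = f ≫ φ₁) (hr : r₀ ≫ f = g ≫ r₁)
    (h₀ : φ₀ ≫ r₀ = 𝟙 _) (h₁ : φ₁ ≫ r₁ = 𝟙 _)
    (hs₀ : r₀ ≫ φ₀ + g ≫ s = 𝟙 _) (hs₁ : r₁ ≫ φ₁ + s ≫ g = 𝟙 _)
    (h01 : (ComplexShape.up ℤ).Rel 0 1) :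
    ∃ φ : double f h01 ⟶ double g h01, QuasiIso φ := by
  have hne : (0 : ℤ) ≠ 1 := by simp
  let φ : double f h01 ⟶ double g h01 :=
    mkHomFromDouble h01 hne (φ₀ ≫ (doubleXIso₀ g h01).inv) (φ₁ ≫ (doubleXIso₁ g h01 hne).inv)
      (by simp [double_d _ h01 hne, reassoc_of% hφ])
      (fun k _ => by rw [double_d_eq_zero₀ _ _ _ _ hne.symm, comp_zero])
  let ψ : double g h01 ⟶ double f h01 :=
    mkHomFromDouble h01 hne (r₀ ≫ (doubleXIso₀ f h01).inv) (r₁ ≫ (doubleXIso₁ f h01 hne).inv)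
      (by simp [double_d _ h01 hne, reassoc_of% hr])
      (fun k _ => by rw [double_d_eq_zero₀ _ _ _ _ hne.symm, comp_zero])
  have e₁ : φ ≫ ψ = 𝟙 _ := by
    ext
    · simp [φ, ψ, reassoc_of% h₀]
    · simp [φ, ψ, reassoc_of% h₁]
  -- The homotopy is `s` from degree 1 to degree 0 and zero elsewhere; `eqToHom` only transports
  -- along equalities of degrees.
  let t : ∀ i j : ℤ, (ComplexShape.up ℤ).Rel j i → ((double g h01).X i ⟶ (double g h01).X j) :=
    fun i j _ => if h : i = 1 ∧ j = 0 then
      eqToHom (by rw [h.1]) ≫ (doubleXIso₁ g h01 hne).hom ≫ s ≫ (doubleXIso₀ g h01).inv ≫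
        eqToHom (by rw [h.2]) else 0
  have t10 : t 1 0 h01 = (doubleXIso₁ g h01 hne).hom ≫ s ≫ (doubleXIso₀ g h01).inv := by
    simp [t]
  have e₂ : 𝟙 _ = ψ ≫ φ + Homotopy.nullHomotopicMap' t := by
    ext
    · rw [add_f_apply, Homotopy.nullHomotopicMap'_f (k₂ := -1) (by simp) h01, t10,
        double_d _ h01 hne, double_d_eq_zero₁ _ _ _ _ hne, comp_zero, add_zero]
      simp only [φ, ψ, id_f, comp_f, mkHomFromDouble_f₀, Category.assoc, Iso.inv_hom_id_assoc]
      rw [← Preadditive.comp_add]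
      have := hs₀ =≫ (doubleXIso₀ g h01).inv
      simp only [Preadditive.add_comp, Category.assoc, Category.id_comp] at this
      rw [this, Iso.hom_inv_id]
    · rw [add_f_apply, Homotopy.nullHomotopicMap'_f (k₀ := 2) h01 (by simp), t10,
        double_d _ h01 hne, double_d_eq_zero₀ _ _ _ _ hne.symm, zero_comp, zero_add]
      simp only [φ, ψ, id_f, comp_f, mkHomFromDouble_f₁, Category.assoc, Iso.inv_hom_id_assoc]
      rw [← Preadditive.comp_add]
      have := hs₁ =≫ (doubleXIso₁ g h01 hne).inv
      simp only [Preadditive.add_comp, Category.assoc, Category.id_comp] at this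
      rw [this, Iso.hom_inv_id]
  let η : HomotopyEquiv (double f h01) (double g h01) :=
    { hom := φ
      inv := ψ
      homotopyHomInvId := Homotopy.ofEq e₁
      homotopyInvHomId := Homotopy.symm <| (Homotopy.ofEq e₂).trans <|
        ((Homotopy.refl (ψ ≫ φ)).add (Homotopy.nullHomotopy' t)).trans
          (Homotopy.ofEq (add_zero _)) }
  exact ⟨η.hom, η.quasiIso_hom⟩

end Double

/-! ### Perturbing a unit by a locally nilpotent endomorphism -/

section LocallyNilpotent

/-- The sum of a unit and a commuting locally nilpotent endomorphism is bijective. -/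
theorem Module.End.bijective_smul_add_of_locallyNilpotent {R H : Type*} [CommRing R]
    [AddCommGroup H] [Module R H] {c : R} (hc : IsUnit c) (b : R) (u : H →ₗ[R] H)
    (hu : ∀ h, ∃ k : ℕ, u^[k] h = 0) : Function.Bijective (c • (LinearMap.id : H →ₗ[R] H) + b • u) := by
  obtain ⟨c, rfl⟩ := hc
  constructor
  · rw [injective_iff_map_eq_zero]
    intro h hh
    obtain ⟨k, hk⟩ := hu h
    have hh' : (c : R) • h = -(b • u h) := by
      simpa [add_eq_zero_iff_eq_neg] using hh
    -- Applying `u^k` to `c h = -b u h` gives `c u^k h = -b u^(k+1) h = 0`, so the exponent killing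
    -- `h` can be lowered down to 0.
    induction k with
    | zero => simpa using hk
    | succ k ih =>
      apply ih
      have hcomm : ∀ y, u^[k] y = (u ^ k) y := fun y => by rw [Module.End.coe_pow]
      have : (c : R) • (u^[k] h) = 0 := by
        rw [hcomm, ← map_smul, hh', map_neg, map_smul, ← hcomm, ← Function.iterate_succ_apply, hk,
          smul_zero, neg_zero]
      exact (smul_eq_zero_iff_eq c).mp this
  · intro h
    obtain ⟨k, hk⟩ := hu h
    induction k generalizing h with
    | zero => exact ⟨0, by simpa using hk.symm⟩
    | succ k ih =>
      obtain ⟨w, hw⟩ := ih (u h) hk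
      -- As `w` is a preimage of `u h`, the map sends `h - b w` to `c h + b u h - b u h = c h`.
      refine ⟨(↑c⁻¹ : R) • (h - b • w), ?_⟩
      rw [map_smul, map_sub, map_smul, hw]
      simp [smul_smul]

end LocallyNilpotent

/-! ### Arithmetic of `q`-integers -/

namespace QSimpson

section QInt

variable {R : Type u} [CommRing R] {q : R}

theorem qInt_succ (n : ℕ) : qInt q (n + 1) = qInt q n + q ^ n := by
  simp [qInt, Finset.sum_range_succ]

theorem qInt_add (m n : ℕ) : qInt q (m + n) = qInt q m + q ^ m * qInt q n := by
  simp [qInt, Finset.sum_range_add, Finset.mul_sum, pow_add]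

theorem qInt_mul_eq_zero {m : ℕ} (hm : qInt q m = 0) (a : ℕ) : qInt q (a * m) = 0 := by
  induction a with
  | zero => simp [qInt]
  | succ a ih => rw [Nat.succ_mul, qInt_add, ih, hm, mul_zero, add_zero]

/-- If two `q`-integers of coprime indices vanish, then the ring is trivial. -/
theorem subsingleton_of_qInt_eq_zero {m n : ℕ} (hmn : m.Coprime n) (hm : qInt q m = 0)
    (hn : qInt q n = 0) : Subsingleton R := by
  refine subsingleton_of_zero_eq_one ?_
  rcases Nat.lt_or_ge 1 n with h1 | h1
  -- Writing `m a = 1 + n k` turns `(m a)_q = 0` into `1 + q (n k)_q = 0`, where `(n k)_q = 0`.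
  · obtain ⟨a, ha⟩ := Nat.exists_mul_mod_eq_one_of_coprime hmn h1
    have h := qInt_mul_eq_zero hm a
    rw [mul_comm, ← Nat.mod_add_div (m * a) n, ha.2, qInt_add, mul_comm n, qInt_mul_eq_zero hn] at h
    simpa [qInt] using h.symm
  · interval_cases n
    · obtain rfl : m = 1 := by simpa using hmn
      simpa [qInt] using hm.symm
    · simpa [qInt] using hn.symm

/-- By `q`-divisibility only `(i)_q = 0` could fail; as `i` is prime to `p` and `(p)_q = 0`, the
ring is then trivial and every element is a unit. -/
theorem isUnit_qInt {p : ℕ} (hp : p.Prime) (hpq : qInt q p = 0) (hdiv : IsQDivisible q)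
    {i : ℕ} (hi : i ≠ 0) (hip : i < p) : IsUnit (qInt q i) := by
  by_cases h : qInt q i = 0
  · have := subsingleton_of_qInt_eq_zero (Nat.coprime_of_lt_prime hi hip hp).symm h hpq
    exact isUnit_of_subsingleton _
  · exact hdiv i h

variable {A : Type u} [CommRing A] [Algebra R A]

/-- `∂_σ (x ^ (i + 1)) = (i + 1)_q x ^ i`. -/
theorem IsTwistedDerivation.apply_pow_succ {σ : A →ₐ[R] A} {d : A →ₗ[R] A}
    (hd : IsTwistedDerivation σ d d) {x : A} (hσ : σ x = algebraMap R A q * x) (hdx : d x = 1)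
    (i : ℕ) : d (x ^ (i + 1)) = algebraMap R A (qInt q (i + 1)) * x ^ i := by
  induction i with
  | zero => simp [hdx, qInt]
  | succ i ih =>
    rw [pow_succ, ← smul_eq_mul, hd, ih, hdx, map_pow, hσ, qInt_succ (i + 1)]
    simp only [smul_eq_mul, mul_one, map_add, map_pow]
    ring

end QInt

end QSimpson

/-! ### Freeness of the modules of differentials -/

section Kaehler

open KaehlerDifferential Polynomial

/-- If `A` is étale over `R[t]`, then `Ω[A⁄R]` is free on `dt`. -/
theorem KaehlerDifferential.bijective_smul_D_of_etale {R A : Type*} [CommRing R] [CommRing A]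
    [Algebra R A] (f : R[X] →ₐ[R] A) (hf : f.toRingHom.Etale) :
    Function.Bijective (fun a : A => a • D R A (f X)) := by
  let _ : Algebra R[X] A := f.toRingHom.toAlgebra
  have : IsScalarTower R R[X] A := .of_algebraMap_eq' f.comp_algebraMap.symm
  have : Algebra.Etale R[X] A := hf
  let e : A ≃ₗ[A] Ω[A⁄R] :=
    (TensorProduct.AlgebraTensorModule.rid R[X] A A).symm ≪≫ₗ
      TensorProduct.AlgebraTensorModule.congr (.refl A A) (polynomialEquiv R).symm ≪≫ₗ
      tensorKaehlerEquivOfFormallyEtale R R[X] A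
  convert e.bijective using 2 with a
  simp [e]
  rfl

/-- Freeness of the module of differentials on `dx` is stable under base change. -/
theorem KaehlerDifferential.bijective_smul_D_of_isPushout (R S A B : Type*) [CommRing R]
    [CommRing S] [CommRing A] [CommRing B] [Algebra R S] [Algebra R A] [Algebra S B] [Algebra A B]
    [Algebra R B] [IsScalarTower R S B] [IsScalarTower R A B] [Algebra.IsPushout R S A B] (x : A)
    (hx : Function.Bijective (fun a : A => a • D R A x)) :
    Function.Bijective (fun b : B => b • D S B (algebraMap A B x)) := by
  let e : A ≃ₗ[A] Ω[A⁄R] := .ofBijective (LinearMap.toSpanSingleton A _ (D R A x)) hx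
  let e' : B ≃ₗ[B] Ω[B⁄S] :=
    (TensorProduct.AlgebraTensorModule.rid A B B).symm ≪≫ₗ
      TensorProduct.AlgebraTensorModule.congr (.refl B B) e ≪≫ₗ
      tensorKaehlerEquiv R S A B
  convert e'.bijective using 2 with b
  have he : e 1 = D R A x := (LinearEquiv.ofBijective_apply _ _).trans (one_smul A _)
  simp [e', he, tensorKaehlerEquiv_tmul_D]

/-- Transport of the freeness of the module of differentials along isomorphisms of the base ring
and of the algebra. -/
theorem KaehlerDifferential.bijective_smul_D_of_ringEquiv {S S' B B' : Type u} [CommRing S]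
    [CommRing S'] [CommRing B] [CommRing B'] [Algebra S B] [Algebra S' B'] (ε : S ≃+* S')
    (β : B ≃+* B') (h : ∀ s, β (algebraMap S B s) = algebraMap S' B' (ε s)) (y : B)
    (hy : Function.Bijective (fun b : B => b • D S B y)) :
    Function.Bijective (fun b : B' => b • D S' B' (β y)) := by
  let _ : Algebra S S' := ε.toRingHom.toAlgebra
  let _ : Algebra B B' := β.toRingHom.toAlgebra
  let _ : Algebra S B' := ((algebraMap S' B').comp ε.toRingHom).toAlgebra
  have : IsScalarTower S S' B' := .of_algebraMap_eq fun _ => rfl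
  have : IsScalarTower S B B' := .of_algebraMap_eq fun s => (h s).symm
  have : Algebra.IsPushout S S' B B' := by
    -- A square with two parallel isomorphisms is a pushout: the only extension of `g` is `g ∘ β⁻¹`.
    refine ⟨.of_lift_unique _ fun Q _ _ _ _ g => ?_⟩
    refine ⟨{ toFun := fun b => g (β.symm b), map_add' := by simp, map_smul' := fun s b => ?_ },
      ?_, fun g' hg' => ?_⟩
    · obtain ⟨s, rfl⟩ := ε.surjective s
      obtain ⟨b, rfl⟩ := β.surjective b
      have h1 : ε s • β b = β (s • b) := by
        rw [Algebra.smul_def, Algebra.smul_def, map_mul, h]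
      have h2 : ε s • g b = s • g b := algebraMap_smul S' s (g b)
      rw [h1, β.symm_apply_apply, β.symm_apply_apply, map_smul, RingHom.id_apply, h2]
    · ext b
      exact congrArg g (β.symm_apply_apply b)
    · ext b
      obtain ⟨b, rfl⟩ := β.surjective b
      exact (LinearMap.congr_fun hg' b).trans (congrArg g (β.symm_apply_apply b).symm)
  exact bijective_smul_D_of_isPushout S S' B B' y hy

namespace QSimpson

/-- If `Ω[A⁄R]` is free on `dx`, then `Ω[A'⁄R]` is free on `d(1 ⊗ x)`. -/
theorem FrobTwist.bijective_smul_D {R A : Type u} [CommRing R] (F : R →+* R) [CommRing A]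
    [Algebra R A] (x : A) (hx : Function.Bijective (fun a : A => a • D R A x)) :
    Function.Bijective
      (fun b : FrobTwist F A => b • D R (FrobTwist F A) (FrobTwist.one_tmul F x)) := by
  let _ : Algebra A (FrobSource F ⊗[R] A) := Algebra.TensorProduct.rightAlgebra
  -- Base change gives differentials relative to `FrobSource F`; identity maps transport them to
  -- differentials relative to `R` acting through the left factor.
  let ε : FrobSource F ≃+* R := RingEquiv.refl R
  let β : FrobSource F ⊗[R] A ≃+* FrobTwist F A := RingEquiv.refl (FrobSource F ⊗[R] A)
  have h : ∀ s, β (algebraMap (FrobSource F) (FrobSource F ⊗[R] A) s) =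
      algebraMap R (FrobTwist F A) (ε s) := fun _ => rfl
  have hy := bijective_smul_D_of_ringEquiv ε β h _
    (bijective_smul_D_of_isPushout R (FrobSource F) A (FrobSource F ⊗[R] A) x hx)
  exact hy

end QSimpson

end Kaehler

/-! ### Contracting a cyclic shift -/

namespace QSimpson

section TwoTerm

open KaehlerDifferential

variable {R : Type u} [CommRing R]

/-- If `Ω[B⁄R]` is free on `db`, then `n ↦ n ⊗ db` is an isomorphism `N ≃ N ⊗_B Ω[B⁄R]`. -/
theorem exists_linearEquiv_tmul_D {B : Type u} [CommRing B] [Algebra R B] {b : B}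
    (hb : Function.Bijective (fun c : B => c • D R B b))
    (N : Type u) [AddCommGroup N] [Module R N] [Module B N] [IsScalarTower R B N] :
    ∃ e : N ≃ₗ[R] N ⊗[B] Ω[B⁄R], ∀ n, e n = n ⊗ₜ D R B b := by
  let e : B ≃ₗ[B] Ω[B⁄R] := .ofBijective (LinearMap.toSpanSingleton B _ (D R B b)) hb
  let e' : N ≃ₗ[B] N ⊗[B] Ω[B⁄R] :=
    (TensorProduct.rid B N).symm ≪≫ₗ TensorProduct.congr (.refl B N) e
  have he' : ∀ n, e' n = n ⊗ₜ D R B b := fun n => by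
    have he : e 1 = D R B b := (LinearEquiv.ofBijective_apply _ _).trans (one_smul B _)
    simp [e', he]
  refine ⟨{ e' with map_smul' := fun r n => ?_ }, he'⟩
  change e' (r • n) = r • e' n
  rw [he', he', TensorProduct.smul_tmul']

/-- If `(M, dM)` is a direct sum of copies of `H` on which `dM` acts as a cyclic shift, which is
composed with `u` on the component `0` and with an automorphism on the other components, then the
inclusions of the first component in degree `0` and of the last component in degree `1` define a
quasi-isomorphism. -/
theorem exists_quasiIso_twoTermComplex
    {A : Type u} [CommRing A] [Algebra R A] {a : A}
    (ha : Function.Bijective (fun c : A => c • D R A a))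
    {B : Type u} [CommRing B] [Algebra R B] {b : B}
    (hb : Function.Bijective (fun c : B => c • D R B b))
    {H : Type u} [AddCommGroup H] [Module R H] [Module B H] [IsScalarTower R B H]
    {M : Type u} [AddCommGroup M] [Module R M] [Module A M] [IsScalarTower R A M]
    (u : H →ₗ[R] H) (dM : M →ₗ[R] M) {n : ℕ}
    (E : (Fin (n + 1) → H) ≃ₗ[R] M) (w : Fin n → H ≃ₗ[R] H)
    (hE : ∀ g, dM (E g) = E (Fin.snoc (α := fun _ => H) (fun k => w k (g k.succ)) (u (g 0)))) :
    ∃ φ : twoTermComplex u b ⟶ twoTermComplex dM a, QuasiIso φ := by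
  obtain ⟨eM, heM⟩ := exists_linearEquiv_tmul_D (R := R) ha M
  obtain ⟨eH, heH⟩ := exists_linearEquiv_tmul_D (R := R) hb H
  have hdM : ∀ g, tmulD dM a (E g) = eM (E (Fin.snoc (α := fun _ => H)
      (fun k => w k (g k.succ)) (u (g 0)))) := fun g => by
    rw [heM, ← hE]; rfl
  have hu : ∀ h, tmulD u b h = eH (u h) := fun h => (heH _).symm
  -- The backward shift, inverting each `w k`: it drops the last component and puts 0 in the first,
  -- so it inverts `dM` away from the retained copies of `H`.
  let s : (Fin (n + 1) → H) →ₗ[R] (Fin (n + 1) → H) :=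
    LinearMap.pi (Fin.cons 0 fun k => (w k).symm.toLinearMap ∘ₗ LinearMap.proj k.castSucc)
  have hs : ∀ g, s g = Fin.cons (α := fun _ => H) 0 fun k => (w k).symm (g k.castSucc) := fun g => by
    ext i
    refine Fin.cases ?_ (fun k => ?_) i <;> simp [s]
  refine HomologicalComplex.exists_quasiIso_double _ _
    (ModuleCat.ofHom (E.toLinearMap ∘ₗ LinearMap.single R (fun _ => H) 0))
    (ModuleCat.ofHom (eM.toLinearMap ∘ₗ E.toLinearMap ∘ₗ
      LinearMap.single R (fun _ => H) (Fin.last n) ∘ₗ eH.symm.toLinearMap))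
    (ModuleCat.ofHom (LinearMap.proj 0 ∘ₗ E.symm.toLinearMap))
    (ModuleCat.ofHom (eH.toLinearMap ∘ₗ LinearMap.proj (Fin.last n) ∘ₗ E.symm.toLinearMap ∘ₗ
      eM.symm.toLinearMap))
    (ModuleCat.ofHom (E.toLinearMap ∘ₗ s ∘ₗ E.symm.toLinearMap ∘ₗ eM.symm.toLinearMap))
    ?_ ?_ ?_ ?_ ?_ ?_ (by simp)
  · ext h
    change tmulD dM a (E (Pi.single 0 h)) =
      eM (E (Pi.single (Fin.last n) (eH.symm (tmulD u b h))))
    rw [hdM, hu, eH.symm_apply_apply]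
    congr 2
    ext i
    refine Fin.lastCases ?_ (fun k => ?_) i <;> simp [Fin.castSucc_ne_last]
  · ext m
    obtain ⟨g, rfl⟩ := E.surjective m
    change tmulD u b (E.symm (E g) 0) =
      eH (E.symm (eM.symm (tmulD dM a (E g))) (Fin.last n))
    simp [hdM, hu]
  · ext h
    change E.symm (E (Pi.single 0 h)) 0 = h
    simp
  · ext h
    change eH (E.symm (eM.symm (eM (E (Pi.single (Fin.last n) (eH.symm h))))) (Fin.last n)) = h
    simp
  · ext m
    obtain ⟨g, rfl⟩ := E.surjective m
    change E (Pi.single 0 (E.symm (E g) 0)) + E (s (E.symm (eM.symm (tmulD dM a (E g))))) = E g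
    rw [hdM, ← map_add, eM.symm_apply_apply, E.symm_apply_apply, E.symm_apply_apply, hs]
    congr 1
    ext i
    refine Fin.cases ?_ (fun k => ?_) i <;> simp
  · ext z
    obtain ⟨m, rfl⟩ := eM.surjective z
    obtain ⟨g, rfl⟩ := E.surjective m
    change eM (E (Pi.single (Fin.last n) (eH.symm (eH (E.symm (eM.symm (eM (E g)))
      (Fin.last n)))))) + tmulD dM a (E (s (E.symm (eM.symm (eM (E g)))))) = eM (E g)
    simp only [LinearEquiv.symm_apply_apply]
    rw [hdM, ← map_add, ← map_add, hs]
    congr 2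
    ext i
    refine Fin.lastCases ?_ (fun k => ?_) i <;> simp [Fin.castSucc_ne_last]

end TwoTerm

end QSimpson

/-! ### The derivation in the basis of powers of `x` -/

theorem proposition5p3
    (p : ℕ) (hp : p.Prime)
    {R : Type u} [CommRing R] (q : R)
    (hpq : QSimpson.qInt q p = 0) (hdiv : QSimpson.IsQDivisible q)
    (F : R →+* R) (hF : QSimpson.IsFrobeniusLift p F)
    {A : Type u} [CommRing A] [Algebra R A]
    -- the étale framing and the coordinate `x`
    (f : Polynomial R →ₐ[R] A) (hf : f.toRingHom.Etale)
    (x : A) (hx : x = f Polynomial.X)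
    -- the endomorphism `σ` and the `σ`-derivation `∂_σ` of `A`
    (σ : A →ₐ[R] A) (hσ : σ x = algebraMap R A q * x)
    (d : A →ₗ[R] A) (hd : QSimpson.IsTwistedDerivation σ d d) (hdx : d x = 1)
    -- the Frobenius `F^* : A' → A`, written as the structure map of an `A'`-algebra
    [Algebra (QSimpson.FrobTwist F A) A] [IsScalarTower R (QSimpson.FrobTwist F A) A]
    (hFx : algebraMap (QSimpson.FrobTwist F A) A (QSimpson.FrobTwist.one_tmul F x) = x ^ p)
    (hbasis : ∃ b : Module.Basis (Fin p) (QSimpson.FrobTwist F A) A,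
      ∀ i : Fin p, b i = x ^ (i : ℕ))
    -- the two quasi-nilpotent objects
    {M : Type u} [AddCommGroup M] [Module R M] [Module A M] [IsScalarTower R A M]
    (dM : M →ₗ[R] M) (hdM : QSimpson.IsTwistedDerivation σ d dM)
    (hM : QSimpson.IsQuasiNilpotent dM)
    {H : Type u} [AddCommGroup H] [Module R H] [Module (QSimpson.FrobTwist F A) H]
    [IsScalarTower R (QSimpson.FrobTwist F A) H]
    (uH : H →ₗ[QSimpson.FrobTwist F A] H) (hH : QSimpson.IsQuasiNilpotent uH)
    (hMH : QSimpson.Corresponds p σ d x dM uH) :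
    ∃ φ : QSimpson.higgs F x uH ⟶ QSimpson.qDeRham (R := R) x dM, QuasiIso φ := by
  open QSimpson in
  obtain ⟨b, hb⟩ := hbasis
  obtain ⟨D, ⟨hD, hD1⟩, e, he⟩ := hMH
  obtain ⟨n, rfl⟩ : ∃ n, p = n + 1 := Nat.exists_eq_succ_of_ne_zero hp.ne_zero
  have hΩ := KaehlerDifferential.bijective_smul_D_of_etale f hf
  rw [← hx] at hΩ
  let E₀ : (Fin (n + 1) → H) ≃ₗ[FrobTwist F A] A ⊗[FrobTwist F A] H :=
    (Finsupp.linearEquivFunOnFinite _ _ _).symm ≪≫ₗ (TensorProduct.equivFinsuppOfBasisLeft b).symm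
  have hE₀ : ∀ g, E₀ g = ∑ i : Fin (n + 1), (x ^ (i : ℕ)) ⊗ₜ g i := fun g => by
    simp [E₀, TensorProduct.equivFinsuppOfBasisLeft_symm_apply, Finsupp.sum_fintype, hb]
  let E : (Fin (n + 1) → H) ≃ₗ[R] M := E₀.restrictScalars R ≪≫ₗ e.restrictScalars R
  -- Index `k` stands for the power `x^(k+1)`, with `0 < k + 1 < p`. The second coefficient comes
  -- from `σ(x^(k+1)) x^n = q^(k+1) x^(n+1) x^k`, where `x^(n+1) = x^p` is the image of `1 ⊗ x`.
  let w (k : Fin n) : H ≃ₗ[FrobTwist F A] H :=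
    .ofBijective _ (Module.End.bijective_smul_add_of_locallyNilpotent
      (c := algebraMap R (FrobTwist F A) (qInt q (k + 1)))
      ((isUnit_qInt hp hpq hdiv (by omega) (by omega)).map _)
      (algebraMap R (FrobTwist F A) (q ^ (k + 1 : ℕ)) * FrobTwist.one_tmul F x) uH hH)
  have hsmul : ∀ (c : FrobTwist F A) (a : A) (h : H),
      a ⊗ₜ[FrobTwist F A] (c • h) = (algebraMap (FrobTwist F A) A c * a) ⊗ₜ h := fun c a h => by
    rw [← TensorProduct.smul_tmul, Algebra.smul_def]
  have hD0 : ∀ h : H, D (1 ⊗ₜ h) = (x ^ n) ⊗ₜ uH h := hD1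
  have hDs : ∀ (k : Fin n) (h : H), D ((x ^ (k + 1 : ℕ)) ⊗ₜ h) = (x ^ (k : ℕ)) ⊗ₜ w k h := by
    intro k h
    have h1 : (x ^ (k + 1 : ℕ)) ⊗ₜ[FrobTwist F A] h =
        (x ^ (k + 1 : ℕ)) • ((1 : A) ⊗ₜ[FrobTwist F A] h) := by
      rw [TensorProduct.smul_tmul', smul_eq_mul, mul_one]
    have h2 : w k h = algebraMap R (FrobTwist F A) (qInt q (k + 1)) • h +
        (algebraMap R (FrobTwist F A) (q ^ (k + 1 : ℕ)) * FrobTwist.one_tmul F x) • uH h := rfl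
    rw [h1, hD, hD0, hd.apply_pow_succ hσ hdx, h2, TensorProduct.tmul_add, hsmul, hsmul, map_mul,
      hFx, ← IsScalarTower.algebraMap_apply, ← IsScalarTower.algebraMap_apply, map_pow, hσ,
      TensorProduct.smul_tmul', TensorProduct.smul_tmul', smul_eq_mul, smul_eq_mul, mul_one]
    congr 2
    rw [map_pow]
    ring
  refine exists_quasiIso_twoTermComplex hΩ (FrobTwist.bijective_smul_D F x hΩ)
    (uH.restrictScalars R) dM E (fun k => (w k).restrictScalars R) fun g => ?_
  change dM (e (E₀ g)) = e (E₀ _)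
  -- The source sum is split at its first term and the target sum at its last, matching the cyclic
  -- shift.
  rw [← he, hE₀, hE₀, Fin.sum_univ_succ, Fin.sum_univ_castSucc, map_add, map_sum, add_comm]
  congr 2
  · refine Finset.sum_congr rfl fun k _ => ?_
    rw [Fin.val_succ, hDs, Fin.snoc_castSucc]
    rfl
  · rw [Fin.snoc_last, Fin.val_zero, pow_zero, hD0]
    rfl
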